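/- Let $N\in\mathbb N$ and $\mathbb N=\{0,1,2,\dots\}$. Let $\gamma\subset\mathbb C$ be a smooth curve without self-intersections, oriented from its finite end point $0$ to its other end point $\infty$, which meets each circle $|z|=R$, $R>0$, exactly once. Let $W:\gamma\to\mathbb C^{N\times N}$ be a Laguerre type matrix of weights on $\gamma$, that is: - on $\gamma\setminus\{0\}$ every entry of $W$ is a finite sum $W^{(j,k)}(z)=\sum_{m\in I_{j,k}}h_m(z)\,z^{\alpha_m}\log^{p_m}z$ with $\alpha_m>-1$ real, $p_m\in\mathbb N$, and $h_m$ Hölder continuous, bounded and non-vanishing on $\gamma$ (the logarithm and the powers being determined continuously along $\gamma$); - $W$ is regular: all the moments $W_n=\frac1{2\pi i}\int_\gamma z^nW(z)\,dz$ exist (as absolutely convergent integrals) and $\det[W_{j+k}]_{j,k=0,\dots,n}\neq0$ for all $n\in\mathbb N$. Then there are unique sequences of monic matrix polynomials $P_n^{\mathsf L}(z)=I_Nz^n+\cdots$ and $P_n^{\mathsf R}(z)=I_Nz^n+\cdots$ and of nonsingular matrices $C_n\in\mathbb C^{N\times N}$, $n\in\mathbb N$, with $$\frac1{2\pi i}\int_\gamma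 P_n^{\mathsf L}(z)W(z)z^k\,dz=\delta_{n,k}C_n^{-1},\qquad \frac1{2\pi i}\int_\gamma z^kW(z)P_n^{\mathsf R}(z)\,dz=\delta_{n,k}C_n^{-1},\qquad k=0,1,\dots,n .$$ For $n\in\mathbb N$ and $z\in\mathbb C\setminus\gamma$ put $$Q_n^{\mathsf L}(z)=\frac1{2\pi i}\int_\gamma\frac{P_n^{\mathsf L}(z')}{z'-z}W(z')\,dz',\qquad Q_n^{\mathsf R}(z)=\frac1{2\pi i}\int_\gamma W(z')\frac{P_n^{\mathsf R}(z')}{z'-z}\,dz',$$ and use the conventions $P_{-1}^{\mathsf L}=P_{-1}^{\mathsf R}=0_N$, $C_{-1}$ any nonsingular matrix, $Q_{-1}^{\mathsf L}=Q_{-1}^{\mathsf R}=-C_{-1}^{-1}$. Let $$Y_n^{\mathsf L}(z)=\begin{bmatrix}P_n^{\mathsf L}(z)&Q_n^{\mathsf L}(z)\\-C_{n-1}P_{n-1}^{\mathsf L}(z)&-C_{n-1}Q_{n-1}^{\mathsf L}(z)\end{bmatrix},\qquad Y_n^{\mathsf R}(z)=\begin{bmatrix}P_n^{\mathsf R}(z)&-P_{n-1}^{\mathsf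 R}(z)C_{n-1}\\Q_n^{\mathsf R}(z)&-Q_{n-1}^{\mathsf R}(z)C_{n-1}\end{bmatrix}.$$ Then for every $n\in\mathbb N$ and every $z\in\mathbb C\setminus\gamma$ the matrix $Y_n^{\mathsf L}(z)$ is invertible and $$\big(Y_n^{\mathsf L}(z)\big)^{-1}=\begin{bmatrix}0_N&I_N\\-I_N&0_N\end{bmatrix}Y_n^{\mathsf R}(z)\begin{bmatrix}0_N&-I_N\\I_N&0_N\end{bmatrix},$$ and, entrywise, $$Q_n^{\mathsf L}(z)P_{n-1}^{\mathsf R}(z)-P_n^{\mathsf L}(z)Q_{n-1}^{\mathsf R}(z)=C_{n-1}^{-1},$$ $$P_{n-1}^{\mathsf L}(z)Q_n^{\mathsf R}(z)-Q_{n-1}^{\mathsf L}(z)P_n^{\mathsf R}(z)=C_{n-1}^{-1},$$ $$Q_n^{\mathsf L}(z)P_n^{\mathsf R}(z)-P_n^{\mathsf L}(z)Q_n^{\mathsf R}(z)=0_N .$$ -/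

import Mathlib

open Set Filter Topology MeasureTheory
open scoped Polynomial

/-- A parametrization `γ : [0, ∞) → ℂ` of a smooth curve without self-intersections, going from the
finite end point `0` to the end point `∞`, that meets every circle `|z| = R`, `R > 0`, exactly
once.  Only the values of `γ` on `[0, ∞)` matter. -/
structure IsLaguerreCurve (γ : ℝ → ℂ) : Prop where
  smooth : ContDiffOn ℝ 1 γ (Ici 0)
  regular : ∀ t ∈ Ici (0 : ℝ), derivWithin γ (Ici 0) t ≠ 0
  injOn : InjOn γ (Ici 0)
  start : γ 0 = 0
  tendsto_infty : Tendsto (fun t => ‖γ t‖) atTop atTop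
  meets_circle_once : ∀ R : ℝ, 0 < R → ∃! t : ℝ, 0 ≤ t ∧ ‖γ t‖ = R

/-- The trace of the curve, as a subset of the complex plane. -/
def curveTrace (γ : ℝ → ℂ) : Set ℂ := γ '' Ici 0

/-- The entrywise line integral `(1 / 2πi) ∫_γ F(ζ) dζ` of a matrix function. -/
noncomputable def lineIntegral {N : ℕ} (γ : ℝ → ℂ) (F : ℂ → Matrix (Fin N) (Fin N) ℂ) :
    Matrix (Fin N) (Fin N) ℂ :=
  Matrix.of fun a b =>
    (2 * (Real.pi : ℂ) * Complex.I)⁻¹ * ∫ t in Ioi (0 : ℝ), F (γ t) a b * deriv γ t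

/-- The moment `W_n = (1 / 2πi) ∫_γ zⁿ W(z) dz`. -/
noncomputable def moment {N : ℕ} (γ : ℝ → ℂ) (W : ℂ → Matrix (Fin N) (Fin N) ℂ) (n : ℕ) :
    Matrix (Fin N) (Fin N) ℂ :=
  lineIntegral γ fun ζ => ζ ^ n • W ζ

/-- The block Hankel matrix `[W_{j+k}]`, `j, k = 0, …, n`. -/
noncomputable def blockHankel {N : ℕ} (γ : ℝ → ℂ) (W : ℂ → Matrix (Fin N) (Fin N) ℂ) (n : ℕ) :
    Matrix (Fin (n + 1) × Fin N) (Fin (n + 1) × Fin N) ℂ :=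
  Matrix.of fun x y => moment γ W ((x.1 : ℕ) + (y.1 : ℕ)) x.2 y.2

/-- `W` is regular: all moments exist (as absolutely convergent integrals) and no block Hankel
matrix of moments is singular. -/
structure IsRegularWeight {N : ℕ} (γ : ℝ → ℂ) (W : ℂ → Matrix (Fin N) (Fin N) ℂ) : Prop where
  moments_exist : ∀ (n : ℕ) (a b : Fin N),
    IntegrableOn (fun t => (γ t ^ n * W (γ t) a b) * deriv γ t) (Ioi 0)
  hankel_det_ne_zero : ∀ n : ℕ, (blockHankel γ W n).det ≠ 0

/-- `h` is Hölder continuous, bounded and non-vanishing on the curve. -/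
structure IsHolderFactor (γ : ℝ → ℂ) (h : ℂ → ℂ) : Prop where
  holder : ∃ K r : NNReal, 0 < r ∧ r ≤ 1 ∧ HolderOnWith K r h (curveTrace γ)
  bounded : ∃ B : ℝ, ∀ z ∈ curveTrace γ, ‖h z‖ ≤ B
  ne_zero : ∀ z ∈ curveTrace γ, h z ≠ 0

/-- `ℓ t` is a determination of `log z` at `z = γ t`, taken continuously along the curve. -/
structure IsLogAlong (γ : ℝ → ℂ) (l : ℝ → ℂ) : Prop where
  continuousOn : ContinuousOn l (Ioi 0)
  exp_eq : ∀ t : ℝ, 0 < t → Complex.exp (l t) = γ t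

/-- Laguerre type matrices of weights on the curve `γ`: regular, and every entry is, on
`γ ∖ {0}`, a finite sum of terms `h(z) z^α log^p z` with `α > -1` real, `p` a natural number and
`h` Hölder continuous, bounded and non-vanishing on `γ`; the logarithm and the powers
`z^α = exp (α log z)` are determined along `γ`.  Only the values of `W` on the curve are ever
used. -/
structure IsLaguerreWeight {N : ℕ} (γ : ℝ → ℂ) (W : ℂ → Matrix (Fin N) (Fin N) ℂ) : Prop where
  curve : IsLaguerreCurve γ
  regular : IsRegularWeight γ W
  entries : ∃ l : ℝ → ℂ, IsLogAlong γ l ∧ ∀ a b : Fin N,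
    ∃ (M : ℕ) (h : Fin M → ℂ → ℂ) (α : Fin M → ℝ) (p : Fin M → ℕ),
      (∀ m, IsHolderFactor γ (h m)) ∧ (∀ m, -1 < α m) ∧
      ∀ t : ℝ, 0 < t →
        W (γ t) a b = ∑ m, h m (γ t) * Complex.exp ((α m : ℂ) * l t) * l t ^ p m

/-- The value `∑ₖ pₖ zᵏ` of a matrix polynomial at the scalar `z`. -/
noncomputable def matEval {N : ℕ} (P : (Matrix (Fin N) (Fin N) ℂ)[X]) (z : ℂ) :
    Matrix (Fin N) (Fin N) ℂ :=
  P.eval (algebraMap ℂ (Matrix (Fin N) (Fin N) ℂ) z)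

/-- `P = I zⁿ + p¹ zⁿ⁻¹ + ⋯ + pⁿ`. -/
def IsMonicOfDegree {N : ℕ} (P : (Matrix (Fin N) (Fin N) ℂ)[X]) (n : ℕ) : Prop :=
  P.natDegree ≤ n ∧ P.coeff n = 1

/-- The conditions characterizing the monic left polynomials `PL n`, the monic right polynomials
`PR n` and the nonsingular matrices `C n` attached to the weight `W` on `γ`. -/
structure IsOrthogonalSystem {N : ℕ} (γ : ℝ → ℂ) (W : ℂ → Matrix (Fin N) (Fin N) ℂ)
    (PL PR : ℕ → (Matrix (Fin N) (Fin N) ℂ)[X]) (C : ℕ → Matrix (Fin N) (Fin N) ℂ) : Prop where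
  monic_left : ∀ n, IsMonicOfDegree (PL n) n
  monic_right : ∀ n, IsMonicOfDegree (PR n) n
  nonsingular : ∀ n, IsUnit (C n)
  orthogonal_left : ∀ n k, k ≤ n →
    lineIntegral γ (fun ζ => ζ ^ k • (matEval (PL n) ζ * W ζ)) = if n = k then (C n)⁻¹ else 0
  orthogonal_right : ∀ n k, k ≤ n →
    lineIntegral γ (fun ζ => ζ ^ k • (W ζ * matEval (PR n) ζ)) = if n = k then (C n)⁻¹ else 0

/-- The left second kind function `(1 / 2πi) ∫_γ P(ζ) W(ζ) / (ζ - z) dζ`. -/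
noncomputable def secondKindL {N : ℕ} (γ : ℝ → ℂ) (W : ℂ → Matrix (Fin N) (Fin N) ℂ)
    (P : (Matrix (Fin N) (Fin N) ℂ)[X]) (z : ℂ) : Matrix (Fin N) (Fin N) ℂ :=
  lineIntegral γ fun ζ => (ζ - z)⁻¹ • (matEval P ζ * W ζ)

/-- The right second kind function `(1 / 2πi) ∫_γ W(ζ) P(ζ) / (ζ - z) dζ`. -/
noncomputable def secondKindR {N : ℕ} (γ : ℝ → ℂ) (W : ℂ → Matrix (Fin N) (Fin N) ℂ)
    (P : (Matrix (Fin N) (Fin N) ℂ)[X]) (z : ℂ) : Matrix (Fin N) (Fin N) ℂ :=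
  lineIntegral γ fun ζ => (ζ - z)⁻¹ • (W ζ * matEval P ζ)

/-- `prevTerm a f n` is `f (n - 1)`, with the conventional value `a` for `f (-1)`. -/
def prevTerm {β : Type*} (a : β) (f : ℕ → β) : ℕ → β
  | 0 => a
  | n + 1 => f n

/-- The left fundamental matrix with blocks `P_n`, `Q_n`, `-C_{n-1} P_{n-1}`, `-C_{n-1} Q_{n-1}`.
At `n = 0`: `P_{-1} = 0`, `C_{-1} = D` and `Q_{-1} = -D⁻¹`, so that the lower blocks
are `0` and `I`. -/
noncomputable def YL {N : ℕ} (γ : ℝ → ℂ) (W : ℂ → Matrix (Fin N) (Fin N) ℂ)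
    (PL : ℕ → (Matrix (Fin N) (Fin N) ℂ)[X]) (C : ℕ → Matrix (Fin N) (Fin N) ℂ)
    (D : Matrix (Fin N) (Fin N) ℂ) (n : ℕ) (z : ℂ) :
    Matrix (Fin N ⊕ Fin N) (Fin N ⊕ Fin N) ℂ :=
  Matrix.fromBlocks
    (matEval (PL n) z)
    (secondKindL γ W (PL n) z)
    (-(prevTerm D C n * prevTerm 0 (fun m => matEval (PL m) z) n))
    (-(prevTerm D C n * prevTerm (-D⁻¹) (fun m => secondKindL γ W (PL m) z) n))

/-- The right fundamental matrix with blocks `P_n`, `-P_{n-1} C_{n-1}`, `Q_n`, `-Q_{n-1} C_{n-1}`,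
with the same conventions at `n = 0`. -/
noncomputable def YR {N : ℕ} (γ : ℝ → ℂ) (W : ℂ → Matrix (Fin N) (Fin N) ℂ)
    (PR : ℕ → (Matrix (Fin N) (Fin N) ℂ)[X]) (C : ℕ → Matrix (Fin N) (Fin N) ℂ)
    (D : Matrix (Fin N) (Fin N) ℂ) (n : ℕ) (z : ℂ) :
    Matrix (Fin N ⊕ Fin N) (Fin N ⊕ Fin N) ℂ :=
  Matrix.fromBlocks
    (matEval (PR n) z)
    (-(prevTerm 0 (fun m => matEval (PR m) z) n * prevTerm D C n))
    (secondKindR γ W (PR n) z)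
    (-(prevTerm (-D⁻¹) (fun m => secondKindR γ W (PR m) z) n * prevTerm D C n))

section HankelAlgebra

variable {N : ℕ}

/-- The block Hankel matrix `[w_{j+k}]`, `j, k = 0, …, n`, of a sequence of matrices. -/
def hankelOf (w : ℕ → Matrix (Fin N) (Fin N) ℂ) (n : ℕ) :
    Matrix (Fin (n + 1) × Fin N) (Fin (n + 1) × Fin N) ℂ :=
  Matrix.of fun x y => w ((x.1 : ℕ) + (y.1 : ℕ)) x.2 y.2

/-- The matrix whose block row is `a 0, …, a n`. -/
def blockRow (a : ℕ → Matrix (Fin N) (Fin N) ℂ) (n : ℕ) :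
    Matrix (Fin N) (Fin (n + 1) × Fin N) ℂ :=
  Matrix.of fun i x => a x.1 i x.2

theorem blockRow_mul_hankelOf (w a : ℕ → Matrix (Fin N) (Fin N) ℂ) (n : ℕ) :
    blockRow a n * hankelOf w n =
      blockRow (fun j => ∑ k ∈ Finset.range (n + 1), a k * w (k + j)) n := by
  ext i x
  simp only [blockRow, hankelOf, Matrix.mul_apply, Matrix.of_apply, Matrix.sum_apply,
    Fintype.sum_prod_type]
  rw [Finset.sum_range (fun k => ∑ c, a k i c * w (k + x.1) c x.2)]

theorem hankelOf_transpose (w : ℕ → Matrix (Fin N) (Fin N) ℂ) (n : ℕ) :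
    hankelOf (fun j => (w j).transpose) n = (hankelOf w n).transpose := by
  ext x y
  simp [hankelOf, add_comm]

variable {w : ℕ → Matrix (Fin N) (Fin N) ℂ}

theorem eq_zero_of_sum_mul_eq_zero (hw : ∀ n, (hankelOf w n).det ≠ 0) (n : ℕ)
    (a : ℕ → Matrix (Fin N) (Fin N) ℂ)
    (ha : ∀ j < n, ∑ k ∈ Finset.range n, a k * w (k + j) = 0) : ∀ k < n, a k = 0 := by
  cases n with
  | zero => intro k hk; omega
  | succ m =>
    have hu : IsUnit (hankelOf w m).det := (hw m).isUnit
    have h0 : blockRow a m * hankelOf w m = 0 := by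
      rw [blockRow_mul_hankelOf]
      ext i x
      simp only [blockRow, Matrix.of_apply]
      rw [ha x.1 x.1.2]
      rfl
    have h1 : blockRow a m = 0 := by
      rw [← Matrix.mul_nonsing_inv_cancel_right (hankelOf w m) (blockRow a m) hu, h0,
        Matrix.zero_mul]
    intro k hk
    ext i j
    exact congrFun (congrFun h1 i) (⟨k, hk⟩, j)

theorem exists_sum_mul_eq (hw : ∀ n, (hankelOf w n).det ≠ 0) (n : ℕ)
    (r : ℕ → Matrix (Fin N) (Fin N) ℂ) :
    ∃ a : ℕ → Matrix (Fin N) (Fin N) ℂ,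
      ∀ j < n, ∑ k ∈ Finset.range n, a k * w (k + j) = r j := by
  cases n with
  | zero => exact ⟨0, fun j hj => by omega⟩
  | succ m =>
    have hu : IsUnit (hankelOf w m).det := (hw m).isUnit
    let X := blockRow r m * (hankelOf w m)⁻¹
    let a : ℕ → Matrix (Fin N) (Fin N) ℂ := fun k =>
      if hk : k < m + 1 then Matrix.of fun i j => X i (⟨k, hk⟩, j) else 0
    have hX : blockRow a m = X := by
      ext i x
      change a x.1 i x.2 = X i x
      rw [show a x.1 = _ from dif_pos x.1.2]
      rfl
    refine ⟨a, fun j hj => ?_⟩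
    have h := blockRow_mul_hankelOf w a m
    rw [hX, Matrix.nonsing_inv_mul_cancel_right _ _ hu] at h
    ext i b
    exact (congrFun (congrFun h i) (⟨j, hj⟩, b)).symm

/-- The coefficients of a monic polynomial of degree `n` orthogonal to lower powers, together with
the invertibility of its norm. -/
theorem exists_monic_coeffs (hw : ∀ n, (hankelOf w n).det ≠ 0) (n : ℕ) :
    ∃ p : ℕ → Matrix (Fin N) (Fin N) ℂ, p n = 1 ∧
      (∀ j < n, ∑ k ∈ Finset.range (n + 1), p k * w (k + j) = 0) ∧
      IsUnit (∑ k ∈ Finset.range (n + 1), p k * w (k + n)) := by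
  obtain ⟨q, hq⟩ := exists_sum_mul_eq hw n (fun j => -w (n + j))
  obtain ⟨a, ha⟩ := exists_sum_mul_eq hw (n + 1) (fun j => if j = n then 1 else 0)
  let p : ℕ → Matrix (Fin N) (Fin N) ℂ := fun k => if k = n then 1 else q k
  have hpn : p n = 1 := if_pos rfl
  have hp : ∀ j < n, ∑ k ∈ Finset.range (n + 1), p k * w (k + j) = 0 := by
    intro j hj
    rw [Finset.sum_range_succ, hpn, one_mul, ← neg_eq_iff_add_eq_zero, ← neg_inj, neg_neg,
      ← hq j hj]
    refine Finset.sum_congr rfl fun k hk => ?_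
    have hk' : k ≠ n := (Finset.mem_range.1 hk).ne
    simp [p, hk']
  refine ⟨p, hpn, hp, ?_⟩
  have hsplit : ∀ j, ∑ k ∈ Finset.range n, (a k - a n * p k) * w (k + j) =
      ∑ k ∈ Finset.range (n + 1), a k * w (k + j) -
        a n * ∑ k ∈ Finset.range (n + 1), p k * w (k + j) := by
    intro j
    rw [Finset.mul_sum, ← Finset.sum_sub_distrib, Finset.sum_range_succ, hpn]
    simp [sub_mul, mul_assoc]
  have hzero := eq_zero_of_sum_mul_eq_zero hw n (fun k => a k - a n * p k) (fun j hj => by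
    rw [hsplit, ha j (by omega), hp j hj, if_neg hj.ne, mul_zero, sub_zero])
  have h := hsplit n
  rw [Finset.sum_eq_zero (fun k hk => by
    rw [show a k - a n * p k = 0 from hzero k (Finset.mem_range.1 hk), zero_mul]),
    ha n (by omega), if_pos rfl] at h
  exact (Matrix.isUnit_iff_isUnit_det _).2
    (Matrix.isUnit_det_of_left_inverse (sub_eq_zero.1 h.symm).symm)

theorem sum_pow_mul_shift {s : ℕ → Matrix (Fin N) (Fin N) ℂ} {z : ℂ}
    (hs : ∀ k, s (k + 1) = z • s k + w k) (k l : ℕ) :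
    z ^ l • s k = s (k + l) - ∑ i ∈ Finset.range l, z ^ (l - 1 - i) • w (k + i) := by
  induction l with
  | zero => simp
  | succ l ih =>
    rw [pow_succ', mul_smul, ih, ← add_assoc, hs, Finset.sum_range_succ, smul_sub,
      Finset.smul_sum]
    have : ∀ i ∈ Finset.range l, z • z ^ (l - 1 - i) • w (k + i) =
        z ^ (l + 1 - 1 - i) • w (k + i) := by
      intro i hi
      have := Finset.mem_range.1 hi
      rw [smul_smul, ← pow_succ']
      congr 2
      omega
    rw [Finset.sum_congr rfl this]
    simp

/-- A Christoffel–Darboux type identity: the Casoratian of two polynomials with coefficients `a`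
and `b` and their second kind functions only involves the moments against lower powers. -/
theorem casoratian_eq {s : ℕ → Matrix (Fin N) (Fin N) ℂ} {z : ℂ}
    (hs : ∀ k, s (k + 1) = z • s k + w k) (a b : ℕ → Matrix (Fin N) (Fin N) ℂ) (n m : ℕ) :
    (∑ k ∈ Finset.range (n + 1), a k * s k) * (∑ l ∈ Finset.range (m + 1), z ^ l • b l) -
      (∑ k ∈ Finset.range (n + 1), z ^ k • a k) * (∑ l ∈ Finset.range (m + 1), s l * b l) =
    (∑ k ∈ Finset.range (n + 1), ∑ i ∈ Finset.range k,
        z ^ (k - 1 - i) • (a k * ∑ l ∈ Finset.range (m + 1), w (l + i) * b l)) -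
      ∑ l ∈ Finset.range (m + 1), ∑ i ∈ Finset.range l,
        z ^ (l - 1 - i) • ((∑ k ∈ Finset.range (n + 1), a k * w (k + i)) * b l) := by
  have key : ∀ k l, a k * s k * (z ^ l • b l) - (z ^ k • a k) * (s l * b l) =
      (∑ i ∈ Finset.range k, z ^ (k - 1 - i) • (a k * (w (l + i) * b l))) -
        ∑ i ∈ Finset.range l, z ^ (l - 1 - i) • (a k * w (k + i) * b l) := by
    intro k l
    have e : a k * s k * (z ^ l • b l) - (z ^ k • a k) * (s l * b l) =
        a k * (z ^ l • s k - z ^ k • s l) * b l := by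
      simp [mul_sub, sub_mul, mul_assoc]
    rw [e, sum_pow_mul_shift hs, sum_pow_mul_shift hs, add_comm l k, sub_sub_sub_cancel_left,
      mul_sub, sub_mul, Finset.mul_sum, Finset.mul_sum, Finset.sum_mul, Finset.sum_mul]
    simp [mul_assoc]
  rw [Finset.sum_mul_sum, Finset.sum_mul_sum, ← Finset.sum_sub_distrib]
  simp_rw [← Finset.sum_sub_distrib, key, Finset.sum_sub_distrib]
  congr 1
  · refine Finset.sum_congr rfl fun k _ => ?_
    rw [Finset.sum_comm]
    simp_rw [Finset.mul_sum, Finset.smul_sum]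
  · rw [Finset.sum_comm]
    refine Finset.sum_congr rfl fun l _ => ?_
    rw [Finset.sum_comm]
    simp_rw [Finset.sum_mul, Finset.smul_sum]

end HankelAlgebra

section Integrals

variable {N : ℕ} {γ : ℝ → ℂ} {W : ℂ → Matrix (Fin N) (Fin N) ℂ}

theorem matEval_eq_sum (P : (Matrix (Fin N) (Fin N) ℂ)[X]) {n : ℕ} (hP : P.natDegree ≤ n)
    (z : ℂ) : matEval P z = ∑ k ∈ Finset.range (n + 1), z ^ k • P.coeff k := by
  rw [matEval, Polynomial.eval_eq_sum_range' (Nat.lt_succ_of_le hP)]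
  refine Finset.sum_congr rfl fun k _ => ?_
  rw [← map_pow, ← Algebra.commutes, Algebra.smul_def]

theorem lineIntegral_sum_mul (A : ℕ → Matrix (Fin N) (Fin N) ℂ) (f : ℕ → ℂ → ℂ) (n : ℕ)
    (hf : ∀ k a b, IntegrableOn (fun t => f k (γ t) * W (γ t) a b * deriv γ t) (Ioi 0)) :
    lineIntegral γ (fun ζ => ∑ k ∈ Finset.range n, f k ζ • (A k * W ζ)) =
      ∑ k ∈ Finset.range n, A k * lineIntegral γ (fun ζ => f k ζ • W ζ) := by
  ext a b
  simp only [lineIntegral, Matrix.of_apply, Matrix.sum_apply, Matrix.mul_apply,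
    Matrix.smul_apply, smul_eq_mul]
  have e : ∀ t, (∑ k ∈ Finset.range n, f k (γ t) * ∑ c, A k a c * W (γ t) c b) * deriv γ t =
      ∑ k ∈ Finset.range n, ∑ c, A k a c * (f k (γ t) * W (γ t) c b * deriv γ t) := by
    intro t
    simp_rw [Finset.mul_sum, Finset.sum_mul]
    exact Finset.sum_congr rfl fun k _ => Finset.sum_congr rfl fun c _ => by ring
  simp_rw [e]
  rw [integral_finsetSum _ fun k _ => integrable_finsetSum _ fun c _ => (hf k c b).const_mul _,
    Finset.mul_sum]
  refine Finset.sum_congr rfl fun k _ => ?_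
  rw [integral_finsetSum _ fun c _ => (hf k c b).const_mul _, Finset.mul_sum]
  refine Finset.sum_congr rfl fun c _ => ?_
  rw [integral_const_mul]
  ring

theorem lineIntegral_transpose (F : ℂ → Matrix (Fin N) (Fin N) ℂ) :
    lineIntegral γ (fun ζ => (F ζ).transpose) = (lineIntegral γ F).transpose := rfl

theorem lineIntegral_sum_mul' (A : ℕ → Matrix (Fin N) (Fin N) ℂ) (f : ℕ → ℂ → ℂ) (n : ℕ)
    (hf : ∀ k a b, IntegrableOn (fun t => f k (γ t) * W (γ t) a b * deriv γ t) (Ioi 0)) :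
    lineIntegral γ (fun ζ => ∑ k ∈ Finset.range n, f k ζ • (W ζ * A k)) =
      ∑ k ∈ Finset.range n, lineIntegral γ (fun ζ => f k ζ • W ζ) * A k := by
  have h := lineIntegral_sum_mul (W := fun ζ => (W ζ).transpose) (fun k => (A k).transpose) f n
    (fun k a b => hf k b a)
  rw [← Matrix.transpose_inj, ← lineIntegral_transpose]
  simpa only [Matrix.transpose_sum, Matrix.transpose_smul, Matrix.transpose_mul,
    ← lineIntegral_transpose] using h

theorem lineIntegral_left (P : (Matrix (Fin N) (Fin N) ℂ)[X]) {n : ℕ} (hP : P.natDegree ≤ n)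
    (g : ℂ → ℂ) (hg : ∀ k a b,
      IntegrableOn (fun t => g (γ t) * γ t ^ k * W (γ t) a b * deriv γ t) (Ioi 0)) :
    lineIntegral γ (fun ζ => g ζ • (matEval P ζ * W ζ)) =
      ∑ k ∈ Finset.range (n + 1), P.coeff k * lineIntegral γ (fun ζ => (g ζ * ζ ^ k) • W ζ) := by
  rw [← lineIntegral_sum_mul P.coeff (fun k ζ => g ζ * ζ ^ k) _ hg]
  congr 1
  ext1 ζ
  rw [matEval_eq_sum P hP, Finset.sum_mul, Finset.smul_sum]
  simp [mul_smul]

theorem lineIntegral_right (P : (Matrix (Fin N) (Fin N) ℂ)[X]) {n : ℕ} (hP : P.natDegree ≤ n)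
    (g : ℂ → ℂ) (hg : ∀ k a b,
      IntegrableOn (fun t => g (γ t) * γ t ^ k * W (γ t) a b * deriv γ t) (Ioi 0)) :
    lineIntegral γ (fun ζ => g ζ • (W ζ * matEval P ζ)) =
      ∑ k ∈ Finset.range (n + 1), lineIntegral γ (fun ζ => (g ζ * ζ ^ k) • W ζ) * P.coeff k := by
  rw [← lineIntegral_sum_mul' P.coeff (fun k ζ => g ζ * ζ ^ k) _ hg]
  congr 1
  ext1 ζ
  rw [matEval_eq_sum P hP, Finset.mul_sum, Finset.smul_sum]
  simp [mul_smul]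

theorem lineIntegral_pow_left (hW : IsRegularWeight γ W) (P : (Matrix (Fin N) (Fin N) ℂ)[X])
    {n : ℕ} (hP : P.natDegree ≤ n) (j : ℕ) :
    lineIntegral γ (fun ζ => ζ ^ j • (matEval P ζ * W ζ)) =
      ∑ k ∈ Finset.range (n + 1), P.coeff k * moment γ W (k + j) := by
  rw [lineIntegral_left P hP (fun ζ => ζ ^ j) fun k a b => by
    simpa only [← pow_add] using hW.moments_exist (j + k) a b]
  simp only [← pow_add, add_comm j]
  rfl

theorem lineIntegral_pow_right (hW : IsRegularWeight γ W) (P : (Matrix (Fin N) (Fin N) ℂ)[X])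
    {n : ℕ} (hP : P.natDegree ≤ n) (j : ℕ) :
    lineIntegral γ (fun ζ => ζ ^ j • (W ζ * matEval P ζ)) =
      ∑ k ∈ Finset.range (n + 1), moment γ W (k + j) * P.coeff k := by
  rw [lineIntegral_right P hP (fun ζ => ζ ^ j) fun k a b => by
    simpa only [← pow_add] using hW.moments_exist (j + k) a b]
  simp only [← pow_add, add_comm j]
  rfl

theorem IsLaguerreCurve.exists_dist_le (hγ : IsLaguerreCurve γ) {z : ℂ}
    (hz : z ∉ curveTrace γ) : ∃ δ > 0, ∀ t, 0 ≤ t → δ ≤ ‖γ t - z‖ := by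
  obtain ⟨T, hT⟩ := (tendsto_atTop.1 hγ.tendsto_infty (‖z‖ + 1)).exists_forall_of_atTop
  have hK : IsClosed (γ '' Icc 0 T) :=
    (isCompact_Icc.image_of_continuousOn
      (hγ.smooth.continuousOn.mono Icc_subset_Ici_self)).isClosed
  have hzK : z ∈ (γ '' Icc 0 T)ᶜ := fun h => hz (image_mono Icc_subset_Ici_self h)
  obtain ⟨ε, hε, hb⟩ := Metric.isOpen_iff.1 hK.isOpen_compl z hzK
  refine ⟨min ε 1, lt_min hε one_pos, fun t ht => ?_⟩
  rcases le_total t T with h | h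
  · refine (min_le_left _ _).trans (le_of_not_gt fun hlt => ?_)
    exact hb (by rwa [Metric.mem_ball, dist_eq_norm]) (mem_image_of_mem γ ⟨ht, h⟩)
  · have h1 := hT t h
    have h2 := norm_sub_norm_le (γ t) z
    exact (min_le_right _ _).trans (by linarith)

theorem IsLaguerreCurve.integrableOn_cauchy (hγ : IsLaguerreCurve γ) (hW : IsRegularWeight γ W)
    {z : ℂ} (hz : z ∉ curveTrace γ) (k : ℕ) (a b : Fin N) :
    IntegrableOn (fun t => (γ t - z)⁻¹ * γ t ^ k * W (γ t) a b * deriv γ t) (Ioi 0) := by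
  obtain ⟨δ, hδ, hd⟩ := hγ.exists_dist_le hz
  have hc : ContinuousOn (fun t => (γ t - z)⁻¹) (Ioi 0) :=
    ((hγ.smooth.continuousOn.mono Ioi_subset_Ici_self).sub continuousOn_const).inv₀
      fun t ht h => by
        have := hd t (le_of_lt ht)
        rw [show γ t - z = 0 from h, norm_zero] at this
        linarith
  have h := (hW.moments_exist k a b).bdd_mul (c := δ⁻¹)
    (hc.aestronglyMeasurable measurableSet_Ioi)
    ((ae_restrict_mem measurableSet_Ioi).mono fun t ht => by
      rw [norm_inv]
      exact inv_anti₀ hδ (hd t (le_of_lt ht)))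
  simpa only [IntegrableOn, mul_assoc] using h

/-- The recursion satisfied by the Cauchy transforms of `ζ ^ k W(ζ)`. -/
theorem IsLaguerreCurve.cauchy_succ (hγ : IsLaguerreCurve γ) (hW : IsRegularWeight γ W)
    {z : ℂ} (hz : z ∉ curveTrace γ) (k : ℕ) :
    lineIntegral γ (fun ζ => ((ζ - z)⁻¹ * ζ ^ (k + 1)) • W ζ) =
      z • lineIntegral γ (fun ζ => ((ζ - z)⁻¹ * ζ ^ k) • W ζ) + moment γ W k := by
  ext a b
  simp only [moment, lineIntegral, Matrix.add_apply, Matrix.of_apply, Matrix.smul_apply,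
    smul_eq_mul]
  rw [mul_left_comm, ← mul_add, ← integral_const_mul z, ← integral_add
    ((hγ.integrableOn_cauchy hW hz k a b).const_mul z) (hW.moments_exist k a b)]
  congr 1
  refine setIntegral_congr_fun measurableSet_Ioi fun t ht => ?_
  have hne : γ t - z ≠ 0 := fun h => hz ⟨t, Ioi_subset_Ici_self ht, sub_eq_zero.1 h⟩
  field_simp
  ring

end Integrals

section OrthogonalSystem

variable {N : ℕ} {γ : ℝ → ℂ} {W : ℂ → Matrix (Fin N) (Fin N) ℂ}
  {PL PR : ℕ → (Matrix (Fin N) (Fin N) ℂ)[X]} {C : ℕ → Matrix (Fin N) (Fin N) ℂ}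

/-- The polynomial with coefficients `p k`, `k ≤ n`. -/
noncomputable def polyOfCoeffs (p : ℕ → Matrix (Fin N) (Fin N) ℂ) (n : ℕ) :
    (Matrix (Fin N) (Fin N) ℂ)[X] :=
  ∑ k ∈ Finset.range (n + 1), Polynomial.monomial k (p k)

theorem coeff_polyOfCoeffs (p : ℕ → Matrix (Fin N) (Fin N) ℂ) {n k : ℕ} (hk : k < n + 1) :
    (polyOfCoeffs p n).coeff k = p k := by
  simp [polyOfCoeffs, Polynomial.finsetSum_coeff, Polynomial.coeff_monomial]
  omega

theorem isMonicOfDegree_polyOfCoeffs {p : ℕ → Matrix (Fin N) (Fin N) ℂ} {n : ℕ}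
    (hp : p n = 1) : IsMonicOfDegree (polyOfCoeffs p n) n :=
  ⟨Polynomial.natDegree_sum_le_of_forall_le _ _ fun _ hk =>
    (Polynomial.natDegree_monomial_le _).trans (Nat.lt_succ_iff.1 (Finset.mem_range.1 hk)),
    (coeff_polyOfCoeffs p n.lt_succ_self).trans hp⟩

theorem IsMonicOfDegree.eq_of_coeff {P Q : (Matrix (Fin N) (Fin N) ℂ)[X]} {n : ℕ}
    (hP : IsMonicOfDegree P n) (hQ : IsMonicOfDegree Q n)
    (h : ∀ k < n, P.coeff k - Q.coeff k = 0) : P = Q := by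
  ext1 k
  rcases lt_trichotomy k n with hk | rfl | hk
  · exact sub_eq_zero.1 (h k hk)
  · rw [hP.2, hQ.2]
  · rw [Polynomial.coeff_eq_zero_of_natDegree_lt (hP.1.trans_lt hk),
      Polynomial.coeff_eq_zero_of_natDegree_lt (hQ.1.trans_lt hk)]

theorem exists_isOrthogonalSystem (hW : IsRegularWeight γ W) :
    ∃ (PL PR : ℕ → (Matrix (Fin N) (Fin N) ℂ)[X]) (C : ℕ → Matrix (Fin N) (Fin N) ℂ),
      IsOrthogonalSystem γ W PL PR C := by
  have hw : ∀ n, (hankelOf (moment γ W) n).det ≠ 0 := hW.hankel_det_ne_zero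
  have hwt : ∀ n, (hankelOf (fun j => (moment γ W j).transpose) n).det ≠ 0 := fun n => by
    rw [hankelOf_transpose, Matrix.det_transpose]
    exact hw n
  choose p hp1 hp hpu using fun n => exists_monic_coeffs hw n
  choose qt hqt1 hqt _ using fun n => exists_monic_coeffs hwt n
  let q : ℕ → ℕ → Matrix (Fin N) (Fin N) ℂ := fun n k => (qt n k).transpose
  have hq1 : ∀ n, q n n = 1 := fun n => by simp [q, hqt1]
  have hq : ∀ n, ∀ j < n, ∑ k ∈ Finset.range (n + 1), moment γ W (k + j) * q n k = 0 :=
    fun n j hj => by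
      rw [← Matrix.transpose_inj, Matrix.transpose_zero, ← hqt n j hj]
      simp [q, Matrix.transpose_sum]
  have heq : ∀ n, ∑ k ∈ Finset.range (n + 1), moment γ W (k + n) * q n k =
      ∑ k ∈ Finset.range (n + 1), p n k * moment γ W (k + n) := fun n => by
    have h1 : ∑ l ∈ Finset.range (n + 1),
        (∑ k ∈ Finset.range (n + 1), p n k * moment γ W (k + l)) * q n l =
        ∑ k ∈ Finset.range (n + 1), p n k * moment γ W (k + n) := by
      rw [Finset.sum_range_succ, Finset.sum_eq_zero fun l hl => by
        rw [hp n l (Finset.mem_range.1 hl), zero_mul], hq1, mul_one, zero_add]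
    have h2 : ∑ k ∈ Finset.range (n + 1),
        p n k * (∑ l ∈ Finset.range (n + 1), moment γ W (l + k) * q n l) =
        ∑ l ∈ Finset.range (n + 1), moment γ W (l + n) * q n l := by
      rw [Finset.sum_range_succ, Finset.sum_eq_zero fun l hl => by
        rw [hq n l (Finset.mem_range.1 hl), mul_zero], hp1, one_mul, zero_add]
    rw [← h1, ← h2]
    simp_rw [Finset.mul_sum, Finset.sum_mul]
    rw [Finset.sum_comm]
    simp_rw [mul_assoc, add_comm]
  have hL : ∀ n, IsMonicOfDegree (polyOfCoeffs (p n) n) n := fun n =>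
    isMonicOfDegree_polyOfCoeffs (hp1 n)
  have hR : ∀ n, IsMonicOfDegree (polyOfCoeffs (q n) n) n := fun n =>
    isMonicOfDegree_polyOfCoeffs (hq1 n)
  refine ⟨fun n => polyOfCoeffs (p n) n, fun n => polyOfCoeffs (q n) n,
    fun n => (∑ k ∈ Finset.range (n + 1), p n k * moment γ W (k + n))⁻¹, hL, hR,
    fun n => (Matrix.isUnit_nonsing_inv_iff).2 (hpu n), fun n k hk => ?_, fun n k hk => ?_⟩
  · rw [lineIntegral_pow_left hW _ (hL n).1, Matrix.nonsing_inv_nonsing_inv _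
      ((Matrix.isUnit_iff_isUnit_det _).1 (hpu n)), Finset.sum_congr rfl fun i hi => by
        rw [coeff_polyOfCoeffs _ (Finset.mem_range.1 hi)]]
    split_ifs with h
    · rw [h]
    · exact hp n k (lt_of_le_of_ne hk (Ne.symm h))
  · rw [lineIntegral_pow_right hW _ (hR n).1, Matrix.nonsing_inv_nonsing_inv _
      ((Matrix.isUnit_iff_isUnit_det _).1 (hpu n)), Finset.sum_congr rfl fun i hi => by
        rw [coeff_polyOfCoeffs _ (Finset.mem_range.1 hi)]]
    split_ifs with h
    · rw [← h, heq]
    · exact hq n k (lt_of_le_of_ne hk (Ne.symm h))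

theorem IsOrthogonalSystem.sum_left (h : IsOrthogonalSystem γ W PL PR C)
    (hW : IsRegularWeight γ W) {n k : ℕ} (hk : k ≤ n) :
    ∑ i ∈ Finset.range (n + 1), (PL n).coeff i * moment γ W (i + k) =
      if n = k then (C n)⁻¹ else 0 := by
  rw [← lineIntegral_pow_left hW _ (h.monic_left n).1, h.orthogonal_left n k hk]

theorem IsOrthogonalSystem.sum_right (h : IsOrthogonalSystem γ W PL PR C)
    (hW : IsRegularWeight γ W) {n k : ℕ} (hk : k ≤ n) :
    ∑ i ∈ Finset.range (n + 1), moment γ W (i + k) * (PR n).coeff i =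
      if n = k then (C n)⁻¹ else 0 := by
  rw [← lineIntegral_pow_right hW _ (h.monic_right n).1, h.orthogonal_right n k hk]

theorem IsOrthogonalSystem.unique {PL' PR' : ℕ → (Matrix (Fin N) (Fin N) ℂ)[X]}
    {C' : ℕ → Matrix (Fin N) (Fin N) ℂ} (hW : IsRegularWeight γ W)
    (h : IsOrthogonalSystem γ W PL PR C) (h' : IsOrthogonalSystem γ W PL' PR' C') :
    PL = PL' ∧ PR = PR' ∧ C = C' := by
  have hw : ∀ n, (hankelOf (moment γ W) n).det ≠ 0 := hW.hankel_det_ne_zero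
  have hwt : ∀ n, (hankelOf (fun j => (moment γ W j).transpose) n).det ≠ 0 := fun n => by
    rw [hankelOf_transpose, Matrix.det_transpose]
    exact hw n
  have hL : PL = PL' := by
    funext n
    refine (h.monic_left n).eq_of_coeff (h'.monic_left n)
      (eq_zero_of_sum_mul_eq_zero hw n _ fun j hj => ?_)
    have e : ∑ i ∈ Finset.range (n + 1), (PL n).coeff i * moment γ W (i + j) =
        ∑ i ∈ Finset.range (n + 1), (PL' n).coeff i * moment γ W (i + j) := by
      rw [h.sum_left hW hj.le, h'.sum_left hW hj.le, if_neg hj.ne', if_neg hj.ne']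
    rw [Finset.sum_range_succ, Finset.sum_range_succ, (h.monic_left n).2,
      (h'.monic_left n).2, add_left_inj] at e
    simp_rw [sub_mul, Finset.sum_sub_distrib, e, sub_self]
  have hR : PR = PR' := by
    funext n
    refine (h.monic_right n).eq_of_coeff (h'.monic_right n) fun k hk => ?_
    rw [← Matrix.transpose_inj]
    refine (eq_zero_of_sum_mul_eq_zero hwt n
      (fun k => ((PR n).coeff k - (PR' n).coeff k).transpose) (fun j hj => ?_) k hk).trans
        Matrix.transpose_zero.symm
    have e : ∑ i ∈ Finset.range (n + 1), moment γ W (i + j) * (PR n).coeff i =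
        ∑ i ∈ Finset.range (n + 1), moment γ W (i + j) * (PR' n).coeff i := by
      rw [h.sum_right hW hj.le, h'.sum_right hW hj.le, if_neg hj.ne', if_neg hj.ne']
    rw [Finset.sum_range_succ, Finset.sum_range_succ, (h.monic_right n).2,
      (h'.monic_right n).2, add_left_inj] at e
    simp_rw [← Matrix.transpose_mul, ← Matrix.transpose_sum, mul_sub, Finset.sum_sub_distrib, e,
      sub_self, Matrix.transpose_zero]
  refine ⟨hL, hR, funext fun n => ?_⟩
  have e := h.orthogonal_left n n le_rfl
  rw [hL, h'.orthogonal_left n n le_rfl, if_pos rfl, if_pos rfl] at e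
  rw [← Matrix.nonsing_inv_nonsing_inv (C n)
    ((Matrix.isUnit_iff_isUnit_det _).1 (h.nonsingular n)), ← e,
    Matrix.nonsing_inv_nonsing_inv _ ((Matrix.isUnit_iff_isUnit_det _).1 (h'.nonsingular n))]

variable {z : ℂ}

theorem IsOrthogonalSystem.casoratian (h : IsOrthogonalSystem γ W PL PR C)
    (hγ : IsLaguerreCurve γ) (hW : IsRegularWeight γ W) (hz : z ∉ curveTrace γ) (n m : ℕ) :
    secondKindL γ W (PL n) z * matEval (PR m) z - matEval (PL n) z * secondKindR γ W (PR m) z =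
    (∑ k ∈ Finset.range (n + 1), ∑ i ∈ Finset.range k, z ^ (k - 1 - i) • ((PL n).coeff k *
        ∑ l ∈ Finset.range (m + 1), moment γ W (l + i) * (PR m).coeff l)) -
      ∑ l ∈ Finset.range (m + 1), ∑ i ∈ Finset.range l, z ^ (l - 1 - i) •
        ((∑ k ∈ Finset.range (n + 1), (PL n).coeff k * moment γ W (k + i)) * (PR m).coeff l) := by
  rw [← casoratian_eq (s := fun k => lineIntegral γ (fun ζ => ((ζ - z)⁻¹ * ζ ^ k) • W ζ))
      (hγ.cauchy_succ hW hz), matEval_eq_sum _ (h.monic_right m).1,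
    matEval_eq_sum _ (h.monic_left n).1, secondKindL, secondKindR,
    lineIntegral_left _ (h.monic_left n).1 (fun ζ => (ζ - z)⁻¹) (hγ.integrableOn_cauchy hW hz),
    lineIntegral_right _ (h.monic_right m).1 (fun ζ => (ζ - z)⁻¹)
      (hγ.integrableOn_cauchy hW hz)]

theorem IsOrthogonalSystem.left_sum_eq_zero (h : IsOrthogonalSystem γ W PL PR C)
    (hW : IsRegularWeight γ W) {n m d : ℕ} (hd : d ≤ m) :
    ∑ k ∈ Finset.range (d + 1), ∑ i ∈ Finset.range k, z ^ (k - 1 - i) • ((PL n).coeff k *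
        ∑ l ∈ Finset.range (m + 1), moment γ W (l + i) * (PR m).coeff l) = 0 := by
  refine Finset.sum_eq_zero fun k hk => Finset.sum_eq_zero fun i hi => ?_
  rw [Finset.mem_range] at hk hi
  rw [h.sum_right hW (by omega), if_neg (by omega), mul_zero, smul_zero]

theorem IsOrthogonalSystem.right_sum_eq_zero (h : IsOrthogonalSystem γ W PL PR C)
    (hW : IsRegularWeight γ W) {n m d : ℕ} (hd : d ≤ n) :
    ∑ l ∈ Finset.range (d + 1), ∑ i ∈ Finset.range l, z ^ (l - 1 - i) •
        ((∑ k ∈ Finset.range (n + 1), (PL n).coeff k * moment γ W (k + i)) *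
          (PR m).coeff l) = 0 := by
  refine Finset.sum_eq_zero fun k hk => Finset.sum_eq_zero fun i hi => ?_
  rw [Finset.mem_range] at hk hi
  rw [h.sum_left hW (by omega), if_neg (by omega), zero_mul, smul_zero]

theorem IsOrthogonalSystem.casoratian_self (h : IsOrthogonalSystem γ W PL PR C)
    (hγ : IsLaguerreCurve γ) (hW : IsRegularWeight γ W) (hz : z ∉ curveTrace γ) (n : ℕ) :
    secondKindL γ W (PL n) z * matEval (PR n) z -
      matEval (PL n) z * secondKindR γ W (PR n) z = 0 := by
  rw [h.casoratian hγ hW hz, h.left_sum_eq_zero hW le_rfl, h.right_sum_eq_zero hW le_rfl,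
    sub_zero]

theorem IsOrthogonalSystem.casoratian_succ_left (h : IsOrthogonalSystem γ W PL PR C)
    (hγ : IsLaguerreCurve γ) (hW : IsRegularWeight γ W) (hz : z ∉ curveTrace γ) (n : ℕ) :
    secondKindL γ W (PL (n + 1)) z * matEval (PR n) z -
      matEval (PL (n + 1)) z * secondKindR γ W (PR n) z = (C n)⁻¹ := by
  rw [h.casoratian hγ hW hz, h.right_sum_eq_zero hW n.le_succ, sub_zero, Finset.sum_range_succ,
    h.left_sum_eq_zero hW le_rfl, zero_add, Finset.sum_range_succ, h.sum_right hW le_rfl,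
    if_pos rfl, (h.monic_left (n + 1)).2, Finset.sum_eq_zero fun i hi => ?_]
  · simp
  · rw [Finset.mem_range] at hi
    rw [h.sum_right hW hi.le, if_neg hi.ne', mul_zero, smul_zero]

theorem IsOrthogonalSystem.casoratian_succ_right (h : IsOrthogonalSystem γ W PL PR C)
    (hγ : IsLaguerreCurve γ) (hW : IsRegularWeight γ W) (hz : z ∉ curveTrace γ) (n : ℕ) :
    matEval (PL n) z * secondKindR γ W (PR (n + 1)) z -
      secondKindL γ W (PL n) z * matEval (PR (n + 1)) z = (C n)⁻¹ := by
  rw [← neg_sub, h.casoratian hγ hW hz, h.left_sum_eq_zero hW n.le_succ, zero_sub, neg_neg,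
    Finset.sum_range_succ, h.right_sum_eq_zero hW le_rfl, zero_add, Finset.sum_range_succ,
    h.sum_left hW le_rfl, if_pos rfl, (h.monic_right (n + 1)).2,
    Finset.sum_eq_zero fun i hi => ?_]
  · simp
  · rw [Finset.mem_range] at hi
    rw [h.sum_left hW hi.le, if_neg hi.ne', zero_mul, smul_zero]

theorem IsMonicOfDegree.matEval_zero {P : (Matrix (Fin N) (Fin N) ℂ)[X]}
    (hP : IsMonicOfDegree P 0) (z : ℂ) : matEval P z = 1 := by
  simp [matEval_eq_sum P hP.1, hP.2]

end OrthogonalSystem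

/-- The product of the two fundamental matrices from the bilinear identities of their blocks. -/
theorem fromBlocks_mul_symplectic_eq_one {N : ℕ} {p q p' q' r s r' s' c : Matrix (Fin N) (Fin N) ℂ}
    (hc : IsUnit c) (h1 : q * r' - p * s' = c⁻¹) (h2 : p' * s - q' * r = c⁻¹)
    (h3 : q * r - p * s = 0) (h4 : q' * r' - p' * s' = 0) :
    Matrix.fromBlocks p q (-(c * p')) (-(c * q')) *
      (Matrix.fromBlocks 0 1 (-1) 0 * Matrix.fromBlocks r (-(r' * c)) s (-(s' * c)) *
        Matrix.fromBlocks 0 (-1) 1 0) = 1 := by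
  have hdet := (Matrix.isUnit_iff_isUnit_det _).1 hc
  rw [← Matrix.fromBlocks_one]
  simp only [Matrix.fromBlocks_multiply]
  congr 1
  · simp only [zero_mul, one_mul, mul_zero, mul_one, zero_add, add_zero, neg_mul, mul_neg, neg_neg]
    rw [← Matrix.nonsing_inv_mul c hdet, ← h1]
    noncomm_ring
  · simp only [zero_mul, one_mul, mul_zero, mul_one, zero_add, add_zero, neg_mul, mul_neg, neg_neg]
    rw [← h3]
    noncomm_ring
  · simp only [zero_mul, one_mul, mul_zero, mul_one, zero_add, add_zero, neg_mul, mul_neg, neg_neg]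
    trans -(c * (q' * r' - p' * s') * c)
    · noncomm_ring
    · rw [h4, mul_zero, zero_mul, neg_zero]
  · simp only [zero_mul, one_mul, mul_zero, mul_one, zero_add, add_zero, neg_mul, mul_neg, neg_neg]
    rw [← Matrix.mul_nonsing_inv c hdet, ← h2]
    noncomm_ring

theorem mainTheorem2 {N : ℕ} (γ : ℝ → ℂ) (W : ℂ → Matrix (Fin N) (Fin N) ℂ)
    (hW : IsLaguerreWeight γ W) :
    (∃! S : (ℕ → (Matrix (Fin N) (Fin N) ℂ)[X]) × (ℕ → (Matrix (Fin N) (Fin N) ℂ)[X]) ×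
        (ℕ → Matrix (Fin N) (Fin N) ℂ),
      IsOrthogonalSystem γ W S.1 S.2.1 S.2.2) ∧
    ∀ (PL PR : ℕ → (Matrix (Fin N) (Fin N) ℂ)[X]) (C : ℕ → Matrix (Fin N) (Fin N) ℂ),
      IsOrthogonalSystem γ W PL PR C →
      ∀ D : Matrix (Fin N) (Fin N) ℂ, IsUnit D →
      ∀ (n : ℕ) (z : ℂ), z ∉ curveTrace γ →
        (IsUnit (YL γ W PL C D n z) ∧
          (YL γ W PL C D n z)⁻¹ =
            Matrix.fromBlocks 0 1 (-1) 0 * YR γ W PR C D n z * Matrix.fromBlocks 0 (-1) 1 0) ∧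
        secondKindL γ W (PL n) z * prevTerm 0 (fun m => matEval (PR m) z) n
            - matEval (PL n) z * prevTerm (-D⁻¹) (fun m => secondKindR γ W (PR m) z) n
          = (prevTerm D C n)⁻¹ ∧
        prevTerm 0 (fun m => matEval (PL m) z) n * secondKindR γ W (PR n) z
            - prevTerm (-D⁻¹) (fun m => secondKindL γ W (PL m) z) n * matEval (PR n) z
          = (prevTerm D C n)⁻¹ ∧
        secondKindL γ W (PL n) z * matEval (PR n) z
            - matEval (PL n) z * secondKindR γ W (PR n) z = 0 := by
  have hγ := hW.curve
  have hr := hW.regular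
  refine ⟨?_, fun PL PR C h D hD n z hz => ?_⟩
  · obtain ⟨PL, PR, C, h⟩ := exists_isOrthogonalSystem hr
    refine ⟨(PL, PR, C), h, fun S hS => ?_⟩
    obtain ⟨h1, h2, h3⟩ := hS.unique hr h
    exact Prod.ext h1 (Prod.ext h2 h3)
  have h1 : secondKindL γ W (PL n) z * prevTerm 0 (fun m => matEval (PR m) z) n
      - matEval (PL n) z * prevTerm (-D⁻¹) (fun m => secondKindR γ W (PR m) z) n
        = (prevTerm D C n)⁻¹ := by
    cases n with
    | zero => simp [prevTerm, (h.monic_left 0).matEval_zero]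
    | succ n => exact h.casoratian_succ_left hγ hr hz n
  have h2 : prevTerm 0 (fun m => matEval (PL m) z) n * secondKindR γ W (PR n) z
      - prevTerm (-D⁻¹) (fun m => secondKindL γ W (PL m) z) n * matEval (PR n) z
        = (prevTerm D C n)⁻¹ := by
    cases n with
    | zero => simp [prevTerm, (h.monic_right 0).matEval_zero]
    | succ n => exact h.casoratian_succ_right hγ hr hz n
  have h3 := h.casoratian_self hγ hr hz n
  have h4 : prevTerm (-D⁻¹) (fun m => secondKindL γ W (PL m) z) n *
        prevTerm 0 (fun m => matEval (PR m) z) n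
      - prevTerm 0 (fun m => matEval (PL m) z) n *
        prevTerm (-D⁻¹) (fun m => secondKindR γ W (PR m) z) n = 0 := by
    cases n with
    | zero => simp [prevTerm]
    | succ n => exact h.casoratian_self hγ hr hz n
  have hC : IsUnit (prevTerm D C n) := by
    cases n with
    | zero => exact hD
    | succ n => exact h.nonsingular n
  have hY := fromBlocks_mul_symplectic_eq_one hC h1 h2 h3 h4
  exact ⟨⟨(Matrix.isUnit_iff_isUnit_det _).2 (Matrix.isUnit_det_of_right_inverse hY),
    Matrix.inv_eq_right_inv hY⟩, h1, h2, h3⟩
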